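/- Let $m,n\ge 0$. The inorder labeling of a binary tree with $n$ internal nodes labels its nodes by $1,\dots,n$ so that each node has a label larger than all labels in its left subtree and smaller than all labels in its right subtree. Write $\lambda(T,i)$ for the product of the numbers of leaves in the left and right subtrees of the $i$-th node of $T$ in inorder. Let $\mathsf{Asso}_n\subset\mathbb R^n$ be the convex hull of the points $(\lambda(T,1),\dots,\lambda(T,n))$ over all binary trees $T$ with $n$ nodes, let $\overline{\mathsf{Asso}}_m=(m+1)\mathbf 1-\mathsf{Asso}_m$, and let the $(m,n)$-biassociahedron be the Minkowski sum $$\mathsf B_{m,n}=\big(\overline{\mathsf{Asso}}_m\times\mathsf{Asso}_n\big)+\sum_{i\in[m],\,j\in[n]}[\mathbf e_i,\mathbf e_{m+j}]\subset\mathbb R^{m+n}.$$ A binary $(m,n)$-bitree is a triple $(U,D,\mu)$ where $U$ and $D$ are binary trees with $m$ and $n$ nodes, labeled in inorder by $1,\dots,m$ and $m+1,\dots,m+n$ respectively, and $\mu$ is an ordered partition (into nonempty parts, listed from bottom to top) of the nodes of $U$ and $D$ such that: no part meets both $U$ and $D$; no two consecutive parts are both contained in $U$ or both contained in $D$; the part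 of each non-root node of $U$ (resp. $D$) is equal to or after (resp. equal to or before) the part of its parent. Its order $\preccurlyeq$ on $[m+n]$ is given by $i\preccurlyeq j$ if the part of $i$ is strictly before the part of $j$, or there is a (possibly empty) path from $i$ to $j$ in $U$ oriented towards the leaves or in $D$ oriented towards the root. A node is below another one if its part is strictly before the part of the other. Each binary $(m,n)$-bitree corresponds to exactly one vertex of $\mathsf B_{m,n}$, namely the vertex whose normal cone (the cone of linear functionals maximized over $\mathsf B_{m,n}$ at this vertex) is $\{\mathbf x\in\mathbb R^{m+n} : x_i\le x_j \text{ whenever } i\preccurlyeq j\}$, and each vertex of $\mathsf B_{m,n}$ corresponds to exactly one binary $(m,n)$-bitree. For $i\in[m+n]$, the $i$-th coordinate of the vertex corresponding to $(U,D,\mu)$ is - if $i\le m$: $m+1-\lambda(U,i)$ plus the number of nodes of $D$ below the node of $U$ labeled $i$; - if $i\ge m+1$: $\lambda(D,i-m)$ plus the number of nodes of $U$ below the node of $D$ labeled $i$. In particular, the sum of the coordinates is always $\binom{m+1}{2}+\binom{n+1}{2}+mn$. -/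

import Mathlib

open scoped Pointwise

namespace Biassociahedra

/-! ### Binary trees labelled in inorder

A binary `n`-tree is a `T : BinaryTree Unit` with `n` internal nodes, equivalently `n + 1` leaves.
Its nodes are identified with their inorder labels, counted from `0`: in `node () l r`, the labels
smaller than `l.numNodes` belong to `l`, the label `l.numNodes` is the root, and the larger labels,
shifted down by `l.numNodes + 1`, belong to `r`. -/

/-- The subtree of `T` rooted at the node with inorder label `i`
(the leaf `nil` if there is no such node). -/
def subtreeAt : BinaryTree Unit → ℕ → BinaryTree Unit
  | .nil, _ => .nil
  | .node v l r, i =>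
    if i < l.numNodes then subtreeAt l i
    else if i = l.numNodes then .node v l r
    else subtreeAt r (i - (l.numNodes + 1))

/-- The product of the numbers of leaves in the left and right subtrees of the root. -/
def rootLeafProduct : BinaryTree Unit → ℕ
  | .nil => 0
  | .node _ l r => l.numLeaves * r.numLeaves

/-- The product of the numbers of leaves in the left and right subtrees of the node of `T`
with inorder label `i`. -/
def leafProduct (T : BinaryTree Unit) (i : ℕ) : ℕ :=
  rootLeafProduct (subtreeAt T i)

/-- There is a (possibly empty) path towards the root from the node of `T` with inorder label `i`
to the node of `T` with inorder label `j`, that is, `i` lies in the subtree rooted at `j`. -/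
def IsDescendant : BinaryTree Unit → ℕ → ℕ → Prop
  | .nil, _, _ => False
  | .node _ l r, i, j =>
    (j = l.numNodes ∧ i < l.numNodes + r.numNodes + 1) ∨
    (j < l.numNodes ∧ i < l.numNodes ∧ IsDescendant l i j) ∨
    (l.numNodes < j ∧ l.numNodes < i ∧
      IsDescendant r (i - (l.numNodes + 1)) (j - (l.numNodes + 1)))

/-! ### Polytopes, faces and normal cones -/

/-- `F` is a (nonempty) face of `P`: the set of points of `P` that maximize some linear functional.
The zero functional gives `P` itself. -/
def IsFace {ι : Type*} [Fintype ι] (P F : Set (ι → ℝ)) : Prop :=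
  F.Nonempty ∧ ∃ c : ι → ℝ, F = {x | x ∈ P ∧ ∀ y ∈ P, c ⬝ᵥ y ≤ c ⬝ᵥ x}

/-- `v` is a vertex of `P`. -/
def IsVertex {ι : Type*} [Fintype ι] (P : Set (ι → ℝ)) (v : ι → ℝ) : Prop :=
  IsFace P {v}

/-- The normal cone of a face `F` of `P`: the linear functionals maximized over `P` by all of `F`. -/
def normalCone {ι : Type*} [Fintype ι] (P F : Set (ι → ℝ)) : Set (ι → ℝ) :=
  {c | ∀ f ∈ F, ∀ p ∈ P, c ⬝ᵥ p ≤ c ⬝ᵥ f}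

/-- The associahedron in `ℝⁿ`, as the convex hull of Loday's points. -/
def associahedron (n : ℕ) : Set (Fin n → ℝ) :=
  convexHull ℝ {v | ∃ T : BinaryTree Unit, T.numNodes = n ∧ ∀ i : Fin n, v i = leafProduct T i}

/-- The anti-associahedron `(n + 1) 𝟙 - Asso(n)` in `ℝⁿ`. -/
def antiAssociahedron (n : ℕ) : Set (Fin n → ℝ) :=
  {x | ∃ y ∈ associahedron n, ∀ i, x i = (n + 1 : ℝ) - y i}

/-! The coordinates of `ℝᵐ⁺ⁿ` are indexed by `Fin m ⊕ Fin n`: the first `m` coordinates by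
`Sum.inl` and the last `n` coordinates by `Sum.inr`. -/

/-- The Cartesian product of `P ⊆ ℝᵐ` and `Q ⊆ ℝⁿ`, as a subset of `ℝᵐ⁺ⁿ`. -/
def cartesianProduct {m n : ℕ} (P : Set (Fin m → ℝ)) (Q : Set (Fin n → ℝ)) :
    Set (Fin m ⊕ Fin n → ℝ) :=
  {x | (fun i => x (Sum.inl i)) ∈ P ∧ (fun j => x (Sum.inr j)) ∈ Q}

/-- The graphical zonotope of the complete bipartite graph: the Minkowski sum of the segments
`[eᵢ, eₘ₊ⱼ]` for `i ∈ [m]` and `j ∈ [n]`. -/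
noncomputable def bipartiteZonotope (m n : ℕ) : Set (Fin m ⊕ Fin n → ℝ) :=
  ∑ i : Fin m, ∑ j : Fin n,
    segment ℝ (Pi.single (Sum.inl i) 1 : Fin m ⊕ Fin n → ℝ) (Pi.single (Sum.inr j) 1)

/-- The shuffle of `P ⊆ ℝᵐ` and `Q ⊆ ℝⁿ` (a Minkowski sum). -/
noncomputable def shuffle {m n : ℕ} (P : Set (Fin m → ℝ)) (Q : Set (Fin n → ℝ)) :
    Set (Fin m ⊕ Fin n → ℝ) :=
  cartesianProduct P Q + bipartiteZonotope m n

/-- The `(m,n)`-biassociahedron. -/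
noncomputable def biassociahedron (m n : ℕ) : Set (Fin m ⊕ Fin n → ℝ) :=
  shuffle (antiAssociahedron m) (associahedron n)

/-! ### Binary bitrees -/

/-- An ordered partition of a finite set `α` into nonempty parts, given by the function sending an
element to the position (from `0`) of its part. The positions that occur form an initial segment
of `ℕ`, so that the parts are exactly the fibres over this segment. -/
@[ext]
structure OrderedPartition (α : Type*) where
  part : α → ℕ
  exists_part_eq : ∀ x : α, ∀ k < part x, ∃ y : α, part y = k

/-- A binary `(m,n)`-bitree `(U, D, μ)`. The nodes of `U` (resp. `D`) are the `Sum.inl i`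
(resp. `Sum.inr j`), for their inorder labels `i` (resp. `j`), and the parts of `μ` are listed from
bottom to top. Since no part meets both trees, there is no condition on nodes of one tree lying in
a common part that meets both trees. -/
@[ext]
structure BinaryBitree (m n : ℕ) where
  U : BinaryTree Unit
  D : BinaryTree Unit
  μ : OrderedPartition (Fin m ⊕ Fin n)
  numNodes_U : U.numNodes = m
  numNodes_D : D.numNodes = n
  /-- `U` grows up: a node lies in the same part as its ancestors or in a later one. -/
  up : ∀ i j : Fin m, IsDescendant U i j → μ.part (Sum.inl j) ≤ μ.part (Sum.inl i)
  /-- `D` grows down: a node lies in the same part as its ancestors or in an earlier one. -/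
  down : ∀ i j : Fin n, IsDescendant D i j → μ.part (Sum.inr i) ≤ μ.part (Sum.inr j)
  /-- No part meets both `U` and `D`. -/
  pure : ∀ x y, μ.part x = μ.part y → x.isLeft = y.isLeft
  /-- No two consecutive parts are both contained in `U` or both contained in `D`. -/
  alternating : ∀ x y, μ.part y = μ.part x + 1 → x.isLeft ≠ y.isLeft

namespace BinaryBitree

variable {m n : ℕ}

/-- The partial order `≼` of a bitree: `x ≼ y` when the part of `x` is strictly before the part
of `y`, or there is a path from `x` to `y` in `U` oriented towards its leaves or in `D` oriented
towards its root. -/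
def Rel (B : BinaryBitree m n) (x y : Fin m ⊕ Fin n) : Prop :=
  B.μ.part x < B.μ.part y ∨
  (∃ i j : Fin m, x = Sum.inl i ∧ y = Sum.inl j ∧ IsDescendant B.U j i) ∨
  (∃ i j : Fin n, x = Sum.inr i ∧ y = Sum.inr j ∧ IsDescendant B.D i j)

/-- The cone of the points `c` with `c x ≤ c y` whenever `x ≼ y`. -/
def cone (B : BinaryBitree m n) : Set (Fin m ⊕ Fin n → ℝ) :=
  {c | ∀ x y, B.Rel x y → c x ≤ c y}

/-- `v` is the vertex of the biassociahedron corresponding to the binary bitree `B`, that is,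
the vertex whose normal cone is the cone of `B`. -/
def IsVertexOf (B : BinaryBitree m n) (v : Fin m ⊕ Fin n → ℝ) : Prop :=
  IsVertex (biassociahedron m n) v ∧ normalCone (biassociahedron m n) {v} = B.cone

/-- The number of nodes of `D` below the node of `U` labelled `i`. -/
def numBelowU (B : BinaryBitree m n) (i : Fin m) : ℕ :=
  (Finset.univ.filter fun j : Fin n => B.μ.part (Sum.inr j) < B.μ.part (Sum.inl i)).card

/-- The number of nodes of `U` below the node of `D` labelled `j`. -/
def numBelowD (B : BinaryBitree m n) (j : Fin n) : ℕ :=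
  (Finset.univ.filter fun i : Fin m => B.μ.part (Sum.inl i) < B.μ.part (Sum.inr j)).card

end BinaryBitree

end Biassociahedra

namespace Biassociahedra

/-! ### Descendants in binary trees -/

/-! Everything is read off the support function. The number `leafProduct T i` counts the intervals
of labels whose node nearest to the root is `i`. Hence a functional `c` takes at Loday's point a
value of at most the sum over all intervals of the maximum of `c`, with equality exactly when `c`
increases towards the root (`lodayValue_le`). A segment contributes at most the larger value of `c`
at its two ends. Adding these bounds gives `biassoSupport`, and the point of a bitree attains it
exactly on the cone of the bitree (`dotProduct_vertex_eq_iff`).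

Every functional lies in the cone of some bitree (`exists_mem_cone`), so the bound is always
attained and the cones are precisely the normal cones of these points. A strictly monotone
functional shows that each point is a vertex (`exists_unique_maximizer`). Finally, the cone
determines the order, and the order determines the bitree (`cone_injective`), so distinct bitrees
give distinct vertices. -/

theorem IsDescendant.lt {T : BinaryTree Unit} {i j : ℕ} (h : IsDescendant T i j) :
    i < T.numNodes ∧ j < T.numNodes := by
  induction T generalizing i j with
  | nil => exact h.elim
  | node v l r ihl ihr =>
    simp only [BinaryTree.numNodes]
    rcases h with ⟨h1, h2⟩ | ⟨h1, h2, -⟩ | ⟨h1, h2, h3⟩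
    · omega
    · omega
    · have := ihr h3
      omega

theorem IsDescendant.refl {T : BinaryTree Unit} {i : ℕ} (h : i < T.numNodes) :
    IsDescendant T i i := by
  induction T generalizing i with
  | nil => simp [BinaryTree.numNodes] at h
  | node v l r ihl ihr =>
    simp only [BinaryTree.numNodes] at h
    rcases lt_trichotomy i l.numNodes with h1 | h1 | h1
    · exact Or.inr (Or.inl ⟨h1, h1, ihl h1⟩)
    · exact Or.inl ⟨h1, by omega⟩
    · exact Or.inr (Or.inr ⟨h1, h1, ihr (by omega)⟩)

theorem IsDescendant.trans {T : BinaryTree Unit} {i j k : ℕ} (h : IsDescendant T i j)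
    (h' : IsDescendant T j k) : IsDescendant T i k := by
  have hi := h.lt.1
  induction T generalizing i j k with
  | nil => exact h.elim
  | node v l r ihl ihr =>
    simp only [BinaryTree.numNodes] at hi
    rcases h' with ⟨h1, h2⟩ | ⟨h1, h2, h3⟩ | ⟨h1, h2, h3⟩
    · exact Or.inl ⟨h1, by omega⟩
    · rcases h with ⟨g1, g2⟩ | ⟨g1, g2, g3⟩ | ⟨g1, g2, g3⟩
      · omega
      · exact Or.inr (Or.inl ⟨h1, g2, ihl g3 h3 g2⟩)
      · omega
    · rcases h with ⟨g1, g2⟩ | ⟨g1, g2, g3⟩ | ⟨g1, g2, g3⟩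
      · omega
      · omega
      · exact Or.inr (Or.inr ⟨h1, g2, ihr g3 h3 (by omega)⟩)

theorem IsDescendant.antisymm {T : BinaryTree Unit} {i j : ℕ} (h : IsDescendant T i j)
    (h' : IsDescendant T j i) : i = j := by
  induction T generalizing i j with
  | nil => exact h.elim
  | node v l r ihl ihr =>
    rcases h with ⟨h1, h2⟩ | ⟨h1, h2, h3⟩ | ⟨h1, h2, h3⟩ <;>
    rcases h' with ⟨g1, g2⟩ | ⟨g1, g2, g3⟩ | ⟨g1, g2, g3⟩ <;> try omega
    · exact ihl h3 g3
    · have := ihr h3 g3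
      omega

theorem isDescendant_node_root (v : Unit) (l r : BinaryTree Unit) {i : ℕ}
    (h : i < l.numNodes + r.numNodes + 1) : IsDescendant (.node v l r) i l.numNodes :=
  Or.inl ⟨rfl, h⟩

theorem IsDescendant.node_left {v : Unit} {l r : BinaryTree Unit} {i j : ℕ}
    (h : IsDescendant l i j) : IsDescendant (.node v l r) i j :=
  Or.inr (Or.inl ⟨h.lt.2, h.lt.1, h⟩)

theorem IsDescendant.node_right {v : Unit} {l r : BinaryTree Unit} {i j : ℕ}
    (h : IsDescendant r i j) :
    IsDescendant (.node v l r) (l.numNodes + 1 + i) (l.numNodes + 1 + j) :=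
  Or.inr (Or.inr ⟨by omega, by omega, by simpa using h⟩)

/-- A function is monotone on the tree `T`, ordered towards the root, when it is bounded by its
value at the root and monotone on both subtrees. -/
theorem forall_isDescendant_node {L : Type*} [LE L] (v : Unit) (l r : BinaryTree Unit)
    (f : ℕ → L) :
    (∀ i j, IsDescendant (.node v l r) i j → f i ≤ f j) ↔
      (∀ i < l.numNodes + r.numNodes + 1, f i ≤ f l.numNodes) ∧
      (∀ i j, IsDescendant l i j → f i ≤ f j) ∧
      (∀ i j, IsDescendant r i j → f (l.numNodes + 1 + i) ≤ f (l.numNodes + 1 + j)) := by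
  constructor
  · intro h
    exact ⟨fun i hi => h _ _ (isDescendant_node_root v l r hi),
      fun i j hij => h _ _ hij.node_left, fun i j hij => h _ _ hij.node_right⟩
  · rintro ⟨h0, hl, hr⟩ i j (⟨rfl, h2⟩ | ⟨h1, h2, h3⟩ | ⟨h1, h2, h3⟩)
    · exact h0 _ h2
    · exact hl _ _ h3
    · have := hr _ _ h3
      rwa [show l.numNodes + 1 + (i - (l.numNodes + 1)) = i by omega,
        show l.numNodes + 1 + (j - (l.numNodes + 1)) = j by omega] at this

/-- Two trees with the same number of nodes whose descendant relations are contained in a common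
antisymmetric relation coincide. -/
theorem eq_of_isDescendant_le (T T' : BinaryTree Unit) (hT : T.numNodes = T'.numNodes)
    (R : ℕ → ℕ → Prop)
    (hR : ∀ i j, i < T.numNodes → j < T.numNodes → R i j → R j i → i = j)
    (h : ∀ i j, IsDescendant T i j → R i j) (h' : ∀ i j, IsDescendant T' i j → R i j) :
    T = T' := by
  induction T generalizing T' R with
  | nil =>
    cases T' with
    | nil => rfl
    | node => simp [BinaryTree.numNodes] at hT
  | node v l r ihl ihr =>
    cases T' with
    | nil => simp [BinaryTree.numNodes] at hT
    | node v' l' r' =>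
      simp only [BinaryTree.numNodes] at hT hR
      have hk : l.numNodes = l'.numNodes :=
        -- Each of the two roots is a descendant of the other, each time in a different tree.
        hR _ _ (by omega) (by omega) (h' _ _ (isDescendant_node_root v' l' r' (by omega)))
          (h _ _ (isDescendant_node_root v l r (by omega)))
      have e1 : l = l' := ihl l' hk R (fun i j hi hj => hR i j (by omega) (by omega))
        (fun i j hij => h _ _ hij.node_left) (fun i j hij => h' _ _ hij.node_left)
      have e2 : r = r' := by
        refine ihr r' (by omega) (fun i j => R (l.numNodes + 1 + i) (l.numNodes + 1 + j)) ?_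
          (fun i j hij => h _ _ hij.node_right)
          (fun i j hij => by rw [hk]; exact h' _ _ hij.node_right)
        intro i j hi hj h1 h2
        have := hR _ _ (by omega) (by omega) h1 h2
        omega
      rw [e1, e2]

/-- Every function on `{0, …, n - 1}` is monotone on some tree, its decreasing binary search
tree. -/
theorem exists_tree_monotone {L : Type*} [LinearOrder L] (n : ℕ) (f : ℕ → L) :
    ∃ T : BinaryTree Unit, T.numNodes = n ∧ ∀ i j, IsDescendant T i j → f i ≤ f j := by
  induction n using Nat.strong_induction_on generalizing f with
  | _ n ih =>
    rcases Nat.eq_zero_or_pos n with rfl | hn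
    · exact ⟨.nil, rfl, fun _ _ h => h.elim⟩
    · obtain ⟨k, hk, hmax⟩ := Finset.exists_max_image (Finset.range n) f ⟨0, by simpa using hn⟩
      simp only [Finset.mem_range] at hk hmax
      obtain ⟨l, hl, hl'⟩ := ih k hk f
      obtain ⟨r, hr, hr'⟩ := ih (n - (k + 1)) (by omega) (fun i => f (k + 1 + i))
      refine ⟨.node () l r, by simp only [BinaryTree.numNodes]; omega, ?_⟩
      rw [forall_isDescendant_node, hl, hr]
      exact ⟨fun i hi => hmax i (by omega), hl', hr'⟩

/-! ### The support function of the associahedron -/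

/-- The sum of `w a b` over all intervals `[a, b]` of `{0, …, n - 1}`. -/
def intervalSum (n : ℕ) (w : ℕ → ℕ → ℝ) : ℝ :=
  ∑ b ∈ Finset.range n, ∑ a ∈ Finset.range (b + 1), w a b

/-- Intervals are sorted by whether they end before `k`, contain `k`, or start after `k`. -/
theorem intervalSum_split (k r : ℕ) (w : ℕ → ℕ → ℝ) :
    intervalSum (k + r + 1) w = intervalSum k w
      + ∑ b ∈ Finset.range (r + 1), ∑ a ∈ Finset.range (k + 1), w a (k + b)
      + intervalSum r (fun a b => w (k + 1 + a) (k + 1 + b)) := by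
  have h : ∀ b, ∑ a ∈ Finset.range (k + b + 1), w a (k + b) =
      ∑ a ∈ Finset.range (k + 1), w a (k + b)
        + ∑ a ∈ Finset.range b, w (k + 1 + a) (k + b) := by
    intro b
    rw [show k + b + 1 = k + 1 + b by ring, Finset.sum_range_add]
  unfold intervalSum
  rw [add_assoc k r 1, Finset.sum_range_add]
  simp_rw [h]
  rw [Finset.sum_add_distrib, add_assoc]
  congr 2
  -- The term dropped is empty: an interval ending at `k` cannot start after `k`.
  rw [Finset.sum_range_succ']
  simp only [Finset.range_zero, Finset.sum_empty, add_zero]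
  refine Finset.sum_congr rfl fun b _ => Finset.sum_congr rfl fun a _ => ?_
  rw [show k + (b + 1) = k + 1 + b by ring]

/-- The maximum of `c` on the interval `[a, b]`. -/
noncomputable def intervalMax (c : ℕ → ℝ) (a b : ℕ) : ℝ :=
  sSup (c '' Set.Icc a b)

theorem le_intervalMax (c : ℕ → ℝ) {a b i : ℕ} (h : a ≤ i) (h' : i ≤ b) :
    c i ≤ intervalMax c a b :=
  le_csSup ((Set.finite_Icc a b).image c).bddAbove ⟨i, ⟨h, h'⟩, rfl⟩

theorem intervalMax_le (c : ℕ → ℝ) {a b : ℕ} (hab : a ≤ b) {t : ℝ}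
    (h : ∀ i, a ≤ i → i ≤ b → c i ≤ t) : intervalMax c a b ≤ t := by
  refine csSup_le ⟨c a, a, ⟨le_rfl, hab⟩, rfl⟩ ?_
  rintro _ ⟨i, ⟨h1, h2⟩, rfl⟩
  exact h i h1 h2

theorem intervalMax_shift (c : ℕ → ℝ) (k a b : ℕ) :
    intervalMax c (k + a) (k + b) = intervalMax (fun i => c (k + i)) a b := by
  unfold intervalMax
  congr 1
  ext x
  constructor
  · rintro ⟨i, ⟨h1, h2⟩, rfl⟩
    refine ⟨i - k, ⟨by omega, by omega⟩, ?_⟩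
    simp only
    congr 1
    omega
  · rintro ⟨i, ⟨h1, h2⟩, rfl⟩
    exact ⟨k + i, ⟨by omega, by omega⟩, rfl⟩

/-- The value of the linear functional `c` at Loday's point of the tree `T`. -/
def lodayValue (T : BinaryTree Unit) (c : ℕ → ℝ) : ℝ :=
  ∑ i ∈ Finset.range T.numNodes, c i * leafProduct T i

theorem lodayValue_node (v : Unit) (l r : BinaryTree Unit) (c : ℕ → ℝ) :
    lodayValue (.node v l r) c = lodayValue l c
      + ((l.numNodes + 1 : ℝ) * (r.numNodes + 1)) * c l.numNodes
      + lodayValue r (fun i => c (l.numNodes + 1 + i)) := by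
  unfold lodayValue
  simp only [BinaryTree.numNodes]
  rw [show l.numNodes + r.numNodes + 1 = l.numNodes + 1 + r.numNodes by ring,
    Finset.sum_range_add, Finset.sum_range_succ]
  refine congrArg₂ (· + ·) (congrArg₂ (· + ·) ?_ ?_) ?_
  · refine Finset.sum_congr rfl fun i hi => ?_
    simp [leafProduct, subtreeAt, Finset.mem_range.1 hi]
  · simp [leafProduct, subtreeAt, rootLeafProduct, BinaryTree.numLeaves_eq_numNodes_succ]
    ring
  · refine Finset.sum_congr rfl fun i hi => ?_
    have h1 : ¬ l.numNodes + 1 + i < l.numNodes := by omega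
    have h2 : ¬ l.numNodes + 1 + i = l.numNodes := by omega
    simp only [leafProduct, subtreeAt, if_neg h1, if_neg h2]
    congr 4
    omega

/-- The coefficient at the root is the number of intervals containing the root, each of which is
charged the value of `c` there instead of its maximum. The other intervals lie in one of the
subtrees, so induction applies. -/
theorem lodayValue_le (T : BinaryTree Unit) (c : ℕ → ℝ) :
    lodayValue T c ≤ intervalSum T.numNodes (intervalMax c) ∧
    (lodayValue T c = intervalSum T.numNodes (intervalMax c) ↔
      ∀ i j, IsDescendant T i j → c i ≤ c j) := by
  induction T generalizing c with
  | nil => simp [lodayValue, intervalSum, BinaryTree.numNodes, IsDescendant]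
  | node v l r ihl ihr =>
    obtain ⟨hl, hl'⟩ := ihl c
    obtain ⟨hr, hr'⟩ := ihr (fun i => c (l.numNodes + 1 + i))
    have hm : ((l.numNodes + 1 : ℝ) * (r.numNodes + 1)) * c l.numNodes =
        ∑ b ∈ Finset.range (r.numNodes + 1), ∑ a ∈ Finset.range (l.numNodes + 1),
          c l.numNodes := by
      simp
      ring
    have hle : ∀ b ∈ Finset.range (r.numNodes + 1), ∀ a ∈ Finset.range (l.numNodes + 1),
        c l.numNodes ≤ intervalMax c a (l.numNodes + b) := fun b _ a ha =>
      le_intervalMax c (by have := Finset.mem_range.1 ha; omega) (by omega)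
    have hsum := Finset.sum_le_sum fun b hb => Finset.sum_le_sum (hle b hb)
    rw [forall_isDescendant_node, lodayValue_node, hm, BinaryTree.numNodes, intervalSum_split]
    simp_rw [intervalMax_shift]
    refine ⟨by linarith, ?_⟩
    rw [← hl', ← hr']
    have hroot : (∑ b ∈ Finset.range (r.numNodes + 1), ∑ a ∈ Finset.range (l.numNodes + 1),
          c l.numNodes = ∑ b ∈ Finset.range (r.numNodes + 1),
          ∑ a ∈ Finset.range (l.numNodes + 1), intervalMax c a (l.numNodes + b)) ↔
        ∀ i < l.numNodes + r.numNodes + 1, c i ≤ c l.numNodes := by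
      rw [Finset.sum_eq_sum_iff_of_le fun b hb => Finset.sum_le_sum (hle b hb)]
      constructor
      · intro h i hi
        -- The interval of all labels already forces the root to carry the maximum.
        have h1 := h r.numNodes (by simp)
        rw [Finset.sum_eq_sum_iff_of_le (hle _ (by simp))] at h1
        rw [h1 0 (by simp)]
        exact le_intervalMax c (by omega) (by omega)
      · intro h b hb
        refine Finset.sum_congr rfl fun a ha => le_antisymm (hle b hb a ha) ?_
        rw [Finset.mem_range] at ha hb
        exact intervalMax_le c (by omega) fun i _ h2 => h i (by omega)
    rw [← hroot]
    constructor
    · intro h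
      refine ⟨?_, ?_, ?_⟩ <;> linarith
    · rintro ⟨h1, h2, h3⟩
      linarith

theorem lodayValue_one (T : BinaryTree Unit) :
    lodayValue T (fun _ => 1) = ((T.numNodes + 1).choose 2 : ℝ) := by
  rw [(lodayValue_le T fun _ => 1).2.2 fun _ _ _ => le_rfl, intervalSum]
  have : ∀ b, ∀ a ∈ Finset.range (b + 1), intervalMax (fun _ => 1) a b = 1 := by
    intro b a ha
    have ha' := Finset.mem_range.1 ha
    exact le_antisymm (intervalMax_le _ (by omega) fun _ _ _ => le_rfl)
      (le_intervalMax (fun _ => 1) le_rfl (by omega))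
  rw [Finset.sum_congr rfl fun b _ => Finset.sum_congr rfl (this b)]
  induction T.numNodes with
  | zero => simp
  | succ k ih =>
    rw [Finset.sum_range_succ, ih, Nat.choose_succ_succ' (k + 1) 1]
    simp
    ring

end Biassociahedra

namespace Biassociahedra

/-! ### The support function of the biassociahedron -/

/-- The extension by zero of a vector of `ℝⁿ` to a sequence. -/
def extendZero {n : ℕ} (c : Fin n → ℝ) (k : ℕ) : ℝ :=
  if h : k < n then c ⟨k, h⟩ else 0

@[simp]
theorem extendZero_val {n : ℕ} (c : Fin n → ℝ) (i : Fin n) : extendZero c i = c i := by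
  simp [extendZero]

theorem forall_isDescendant_extendZero {n : ℕ} {T : BinaryTree Unit} (hT : T.numNodes = n)
    (c : Fin n → ℝ) :
    (∀ i j, IsDescendant T i j → extendZero c i ≤ extendZero c j) ↔
      ∀ i j : Fin n, IsDescendant T i j → c i ≤ c j := by
  constructor
  · intro h i j hij
    simpa using h i j hij
  · intro h i j hij
    have := hij.lt
    have hi : i < n := by omega
    have hj : j < n := by omega
    simpa [extendZero, hi, hj] using h ⟨i, hi⟩ ⟨j, hj⟩ hij

/-- The support function of the associahedron. -/
noncomputable def assoSupport {n : ℕ} (c : Fin n → ℝ) : ℝ :=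
  intervalSum n (intervalMax (extendZero c))

/-- Loday's point of a binary tree. -/
def lodayPoint (T : BinaryTree Unit) (n : ℕ) (i : Fin n) : ℝ :=
  leafProduct T i

theorem dotProduct_lodayPoint {n : ℕ} {T : BinaryTree Unit} (hT : T.numNodes = n)
    (c : Fin n → ℝ) : c ⬝ᵥ lodayPoint T n = lodayValue T (extendZero c) := by
  subst hT
  unfold lodayValue
  rw [Finset.sum_range]
  simp [dotProduct, lodayPoint]

theorem dotProduct_lodayPoint_le {n : ℕ} {T : BinaryTree Unit} (hT : T.numNodes = n)
    (c : Fin n → ℝ) : c ⬝ᵥ lodayPoint T n ≤ assoSupport c := by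
  subst hT
  rw [dotProduct_lodayPoint rfl, assoSupport]
  exact (lodayValue_le T _).1

theorem dotProduct_lodayPoint_eq_iff {n : ℕ} {T : BinaryTree Unit} (hT : T.numNodes = n)
    (c : Fin n → ℝ) : c ⬝ᵥ lodayPoint T n = assoSupport c ↔
      ∀ i j : Fin n, IsDescendant T i j → c i ≤ c j := by
  rw [← forall_isDescendant_extendZero hT, ← (lodayValue_le T (extendZero c)).2,
    dotProduct_lodayPoint hT, assoSupport, hT]

theorem sum_lodayPoint {n : ℕ} {T : BinaryTree Unit} (hT : T.numNodes = n) :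
    ∑ i, lodayPoint T n i = ((n + 1).choose 2 : ℝ) := by
  subst hT
  rw [← lodayValue_one, lodayValue, Finset.sum_range]
  simp [lodayPoint]

theorem lodayPoint_mem {n : ℕ} {T : BinaryTree Unit} (hT : T.numNodes = n) :
    lodayPoint T n ∈ associahedron n :=
  subset_convexHull ℝ _ ⟨T, hT, fun _ => rfl⟩

theorem dotProduct_le_of_mem_associahedron {n : ℕ} {p : Fin n → ℝ} (hp : p ∈ associahedron n)
    (c : Fin n → ℝ) : c ⬝ᵥ p ≤ assoSupport c := by
  have hconv : Convex ℝ {p : Fin n → ℝ | c ⬝ᵥ p ≤ assoSupport c} :=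
    convex_halfSpace_le ⟨dotProduct_add c, fun a x => dotProduct_smul a c x⟩ _
  refine convexHull_min ?_ hconv hp
  rintro v ⟨T, hT, hv⟩
  obtain rfl : v = lodayPoint T n := funext hv
  exact dotProduct_lodayPoint_le hT c

/-- The support function of the biassociahedron. -/
noncomputable def biassoSupport {m n : ℕ} (c : Fin m ⊕ Fin n → ℝ) : ℝ :=
  (m + 1) * ∑ i, c (Sum.inl i) + assoSupport (fun i => -c (Sum.inl i))
    + assoSupport (fun j => c (Sum.inr j))
    + ∑ i, ∑ j, max (c (Sum.inl i)) (c (Sum.inr j))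

/-- The bounds of the Minkowski summands add up; the reflection of the first factor replaces `c` by
its negative and adds a linear term. Only an upper bound is needed here, since the bitrees supply
attainment. -/
theorem dotProduct_le_of_mem_biassociahedron {m n : ℕ} {p : Fin m ⊕ Fin n → ℝ}
    (hp : p ∈ biassociahedron m n) (c : Fin m ⊕ Fin n → ℝ) : c ⬝ᵥ p ≤ biassoSupport c := by
  obtain ⟨q, ⟨⟨y, hy, hqy⟩, hq2⟩, z, hz, rfl⟩ := hp
  have h1 := dotProduct_le_of_mem_associahedron hy (fun i => -c (Sum.inl i))
  have h2 := dotProduct_le_of_mem_associahedron hq2 (fun j => c (Sum.inr j))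
  have h3 : c ⬝ᵥ z ≤ ∑ i, ∑ j, max (c (Sum.inl i)) (c (Sum.inr j)) := by
    obtain ⟨g, hg, rfl⟩ := (Set.mem_fintype_sum _ _).1 hz
    rw [dotProduct_sum]
    refine Finset.sum_le_sum fun i _ => ?_
    obtain ⟨g', hg', hgi⟩ := (Set.mem_fintype_sum _ _).1 (hg i)
    rw [← hgi, dotProduct_sum]
    refine Finset.sum_le_sum fun j _ => ?_
    obtain ⟨a, b, ha, hb, hab, h⟩ := hg' j
    rw [← h, dotProduct_add, dotProduct_smul, dotProduct_smul, dotProduct_single,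
      dotProduct_single, mul_one, mul_one, smul_eq_mul, smul_eq_mul]
    calc a * c (Sum.inl i) + b * c (Sum.inr j)
        ≤ a * max (c (Sum.inl i)) (c (Sum.inr j)) + b * max (c (Sum.inl i)) (c (Sum.inr j)) := by
          gcongr
          · exact le_max_left _ _
          · exact le_max_right _ _
      _ = _ := by rw [← add_mul, hab, one_mul]
  have h4 : c ⬝ᵥ q = (m + 1) * ∑ i, c (Sum.inl i) + (fun i => -c (Sum.inl i)) ⬝ᵥ y
      + (fun j => c (Sum.inr j)) ⬝ᵥ (fun j => q (Sum.inr j)) := by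
    simp only at hqy
    simp only [dotProduct, Fintype.sum_sum_type, hqy, Finset.mul_sum, ← Finset.sum_add_distrib]
    congr 1
    refine Finset.sum_congr rfl fun i _ => ?_
    ring
  change c ⬝ᵥ (q + z) ≤ _
  rw [dotProduct_add, h4, biassoSupport]
  linarith

/-! ### The vertex of a bitree and the functionals attaining the support bound there -/

namespace BinaryBitree

variable {m n : ℕ}

/-- The vertex of the biassociahedron corresponding to a bitree. -/
def vertex (B : BinaryBitree m n) : Fin m ⊕ Fin n → ℝ :=
  Sum.elim (fun i => (m + 1 : ℝ) - leafProduct B.U i + B.numBelowU i)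
    (fun j => (leafProduct B.D j : ℝ) + B.numBelowD j)

theorem part_inl_ne (B : BinaryBitree m n) (i : Fin m) (j : Fin n) :
    B.μ.part (Sum.inl i) ≠ B.μ.part (Sum.inr j) := fun h => by
  simpa using B.pure _ _ h

/-- This picks one point in each summand: from every segment, the end whose node lies in the later
part. The counts of nodes below record how often each end is picked. -/
theorem vertex_eq (B : BinaryBitree m n) :
    B.vertex = Sum.elim (fun i => (m + 1 : ℝ) - lodayPoint B.U m i) (lodayPoint B.D n) +
      ∑ i, ∑ j, if B.μ.part (Sum.inl i) < B.μ.part (Sum.inr j) then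
        Pi.single (Sum.inr j) 1 else Pi.single (Sum.inl i) 1 := by
  ext x
  rcases x with i | j
  · simp only [vertex, Sum.elim_inl, Pi.add_apply, Finset.sum_apply, lodayPoint, numBelowU]
    congr 1
    rw [Finset.sum_eq_single i]
    · rw [Finset.card_filter, Nat.cast_sum]
      refine Finset.sum_congr rfl fun j _ => ?_
      have := B.part_inl_ne i j
      split_ifs <;> first | omega | simp
    · intro i' _ hi'
      refine Finset.sum_eq_zero fun j _ => ?_
      split_ifs <;> simp [hi'.symm]
    · simp
  · simp only [vertex, Sum.elim_inr, Pi.add_apply, Finset.sum_apply, lodayPoint, numBelowD]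
    congr 1
    rw [Finset.sum_comm, Finset.sum_eq_single j]
    · rw [Finset.card_filter, Nat.cast_sum]
      refine Finset.sum_congr rfl fun i _ => ?_
      split_ifs <;> simp
    · intro j' _ hj'
      refine Finset.sum_eq_zero fun i _ => ?_
      split_ifs <;> simp [hj'.symm]
    · simp

theorem vertex_mem (B : BinaryBitree m n) : B.vertex ∈ biassociahedron m n := by
  rw [vertex_eq]
  refine Set.add_mem_add ⟨⟨lodayPoint B.U m, lodayPoint_mem B.numNodes_U, fun _ => rfl⟩,
    lodayPoint_mem B.numNodes_D⟩ ?_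
  refine Set.finsetSum_mem_finsetSum _ _ _ fun i _ => ?_
  refine Set.finsetSum_mem_finsetSum _ _ _ fun j _ => ?_
  split_ifs
  · exact right_mem_segment ℝ _ _
  · exact left_mem_segment ℝ _ _

theorem dotProduct_vertex (B : BinaryBitree m n) (c : Fin m ⊕ Fin n → ℝ) :
    c ⬝ᵥ B.vertex = (m + 1) * ∑ i, c (Sum.inl i)
      + (fun i => -c (Sum.inl i)) ⬝ᵥ lodayPoint B.U m
      + (fun j => c (Sum.inr j)) ⬝ᵥ lodayPoint B.D n
      + ∑ i, ∑ j, if B.μ.part (Sum.inl i) < B.μ.part (Sum.inr j) then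
          c (Sum.inr j) else c (Sum.inl i) := by
  rw [vertex_eq, dotProduct_add, dotProduct_sum]
  congr 1
  · simp only [dotProduct, Fintype.sum_sum_type, Sum.elim_inl, Sum.elim_inr, Finset.mul_sum,
      ← Finset.sum_add_distrib]
    congr 1
    refine Finset.sum_congr rfl fun i _ => ?_
    ring
  · refine Finset.sum_congr rfl fun i _ => ?_
    rw [dotProduct_sum]
    refine Finset.sum_congr rfl fun j _ => ?_
    split_ifs <;> simp

theorem Rel.part_le {B : BinaryBitree m n} {x y : Fin m ⊕ Fin n} (h : B.Rel x y) :
    B.μ.part x ≤ B.μ.part y := by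
  rcases h with h | ⟨i, j, rfl, rfl, h⟩ | ⟨i, j, rfl, rfl, h⟩
  · exact h.le
  · exact B.up _ _ h
  · exact B.down _ _ h

/-- Between two nodes of the same tree in different parts lies a node of the other tree. -/
theorem exists_between (B : BinaryBitree m n) {x y : Fin m ⊕ Fin n}
    (h : B.μ.part x < B.μ.part y) (hxy : x.isLeft = y.isLeft) :
    ∃ z, z.isLeft ≠ x.isLeft ∧ B.μ.part x < B.μ.part z ∧ B.μ.part z < B.μ.part y := by
  have hne : B.μ.part x + 1 ≠ B.μ.part y := fun he => B.alternating x y he.symm hxy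
  obtain ⟨z, hz⟩ := B.μ.exists_part_eq y (B.μ.part x + 1) (by omega)
  exact ⟨z, (B.alternating x z hz).symm, by omega, by omega⟩

/-- The three conditions match the three kinds of summands. Comparing nodes of one tree in different
parts is redundant, because by alternation a node of the other tree lies between them. -/
theorem mem_cone_iff (B : BinaryBitree m n) (c : Fin m ⊕ Fin n → ℝ) :
    c ∈ B.cone ↔
      (∀ i j : Fin m, IsDescendant B.U i j → c (Sum.inl j) ≤ c (Sum.inl i)) ∧
      (∀ i j : Fin n, IsDescendant B.D i j → c (Sum.inr i) ≤ c (Sum.inr j)) ∧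
      ∀ x y, x.isLeft ≠ y.isLeft → B.μ.part x < B.μ.part y → c x ≤ c y := by
  constructor
  · intro h
    exact ⟨fun i j hij => h _ _ (Or.inr (Or.inl ⟨j, i, rfl, rfl, hij⟩)),
      fun i j hij => h _ _ (Or.inr (Or.inr ⟨i, j, rfl, rfl, hij⟩)),
      fun x y _ hxy => h _ _ (Or.inl hxy)⟩
  · rintro ⟨hU, hD, hc⟩ x y (h | ⟨i, j, rfl, rfl, h⟩ | ⟨i, j, rfl, rfl, h⟩)
    · by_cases hxy : x.isLeft = y.isLeft
      · obtain ⟨z, hz, h1, h2⟩ := B.exists_between h hxy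
        exact (hc x z hz.symm h1).trans (hc z y (hxy ▸ hz) h2)
      · exact hc x y hxy h
    · exact hU _ _ h
    · exact hD _ _ h

/-- Each term is bounded by its counterpart, so the totals agree only if all terms do; the separate
equality cases are the conditions of `mem_cone_iff`. -/
theorem dotProduct_vertex_eq_iff (B : BinaryBitree m n) (c : Fin m ⊕ Fin n → ℝ) :
    c ⬝ᵥ B.vertex = biassoSupport c ↔ c ∈ B.cone := by
  have hU := dotProduct_lodayPoint_le B.numNodes_U (fun i => -c (Sum.inl i))
  have hD := dotProduct_lodayPoint_le B.numNodes_D (fun j => c (Sum.inr j))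
  have hU' := dotProduct_lodayPoint_eq_iff B.numNodes_U (fun i => -c (Sum.inl i))
  have hD' := dotProduct_lodayPoint_eq_iff B.numNodes_D (fun j => c (Sum.inr j))
  have hle : ∀ i : Fin m, ∀ j : Fin n,
      (if B.μ.part (Sum.inl i) < B.μ.part (Sum.inr j) then
        c (Sum.inr j) else c (Sum.inl i)) ≤ max (c (Sum.inl i)) (c (Sum.inr j)) := by
    intro i j
    split_ifs
    · exact le_max_right _ _
    · exact le_max_left _ _
  have hle' : ∀ i ∈ (Finset.univ : Finset (Fin m)), _ :=
    fun i _ => Finset.sum_le_sum fun j (_ : j ∈ Finset.univ) => hle i j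
  have hC := Finset.sum_le_sum hle'
  have hC' : (∑ i : Fin m, ∑ j : Fin n, (if B.μ.part (Sum.inl i) < B.μ.part (Sum.inr j) then
        c (Sum.inr j) else c (Sum.inl i)) = ∑ i, ∑ j, max (c (Sum.inl i)) (c (Sum.inr j))) ↔
      ∀ x y, x.isLeft ≠ y.isLeft → B.μ.part x < B.μ.part y → c x ≤ c y := by
    rw [Finset.sum_eq_sum_iff_of_le hle']
    constructor
    · intro h
      have h' : ∀ i j, _ := fun i j =>
        (Finset.sum_eq_sum_iff_of_le fun j _ => hle i j).1 (h i (Finset.mem_univ i)) j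
          (Finset.mem_univ j)
      rintro (i | i) (j | j) hij hp
      · simp at hij
      · have := h' i j
        rw [if_pos hp] at this
        rw [this]
        exact le_max_left _ _
      · have := h' j i
        rw [if_neg hp.not_gt] at this
        rw [this]
        exact le_max_right _ _
      · simp at hij
    · intro h i _
      refine Finset.sum_congr rfl fun j _ => ?_
      split_ifs with hp
      · exact (max_eq_right (h _ _ (by simp) hp)).symm
      · have := B.part_inl_ne i j
        exact (max_eq_left (h _ _ (by simp) (by omega))).symm
  simp only [neg_le_neg_iff] at hU'
  rw [mem_cone_iff, ← hU', ← hD', ← hC', dotProduct_vertex, biassoSupport]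
  constructor
  · intro h
    refine ⟨?_, ?_, ?_⟩ <;> linarith
  · rintro ⟨h1, h2, h3⟩
    linarith

theorem sum_vertex (B : BinaryBitree m n) :
    ∑ x, B.vertex x = ((m + 1).choose 2 : ℝ) + ((n + 1).choose 2 : ℝ) + (m : ℝ) * (n : ℝ) := by
  have h := B.dotProduct_vertex (fun _ => 1)
  -- The first block sums to `(m + 1) * m` minus this binomial coefficient, which is the coefficient
  -- again.
  have hm : (((m + 1).choose 2 : ℕ) : ℝ) = (m + 1) * m / 2 := by
    rw [Nat.cast_choose_two]
    push_cast
    ring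
  simp only [dotProduct, one_mul, neg_mul, Finset.sum_neg_distrib, sum_lodayPoint B.numNodes_U,
    sum_lodayPoint B.numNodes_D, ite_self, Finset.sum_const, Finset.card_univ, Fintype.card_fin,
    nsmul_eq_mul, mul_one] at h
  rw [h, hm]
  ring

/-! ### The order of a bitree -/

theorem Rel.refl (B : BinaryBitree m n) (x : Fin m ⊕ Fin n) : B.Rel x x := by
  rcases x with i | j
  · exact Or.inr (Or.inl ⟨i, i, rfl, rfl, IsDescendant.refl (by simp [B.numNodes_U])⟩)
  · exact Or.inr (Or.inr ⟨j, j, rfl, rfl, IsDescendant.refl (by simp [B.numNodes_D])⟩)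

theorem Rel.trans {B : BinaryBitree m n} {x y z : Fin m ⊕ Fin n} (h : B.Rel x y)
    (h' : B.Rel y z) : B.Rel x z := by
  have h1 := h.part_le
  have h1' := h'.part_le
  rcases h with h | ⟨i, j, rfl, rfl, h⟩ | ⟨i, j, rfl, rfl, h⟩
  · exact Or.inl (h.trans_le h1')
  · rcases h' with h' | ⟨j', k, hj, rfl, h'⟩ | ⟨j', k, hj, rfl, h'⟩
    · exact Or.inl (h1.trans_lt h')
    · obtain rfl := Sum.inl_injective hj
      exact Or.inr (Or.inl ⟨i, k, rfl, rfl, h'.trans h⟩)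
    · simp at hj
  · rcases h' with h' | ⟨j', k, hj, rfl, h'⟩ | ⟨j', k, hj, rfl, h'⟩
    · exact Or.inl (h1.trans_lt h')
    · simp at hj
    · obtain rfl := Sum.inr_injective hj
      exact Or.inr (Or.inr ⟨i, k, rfl, rfl, h.trans h'⟩)

theorem Rel.antisymm {B : BinaryBitree m n} {x y : Fin m ⊕ Fin n} (h : B.Rel x y)
    (h' : B.Rel y x) : x = y := by
  have h1 := h.part_le
  have h1' := h'.part_le
  rcases h with h | ⟨i, j, rfl, rfl, h⟩ | ⟨i, j, rfl, rfl, h⟩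
  · omega
  · rcases h' with h' | ⟨j', k, hj, hk, h'⟩ | ⟨j', k, hj, hk, h'⟩
    · omega
    · obtain rfl := Sum.inl_injective hj
      obtain rfl := Sum.inl_injective hk
      rw [Fin.ext (h'.antisymm h)]
    · simp at hj
  · rcases h' with h' | ⟨j', k, hj, hk, h'⟩ | ⟨j', k, hj, hk, h'⟩
    · omega
    · simp at hj
    · obtain rfl := Sum.inr_injective hj
      obtain rfl := Sum.inr_injective hk
      rw [Fin.ext (h.antisymm h')]

theorem rel_iff_part_lt (B : BinaryBitree m n) {x y : Fin m ⊕ Fin n}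
    (hxy : x.isLeft ≠ y.isLeft) : B.Rel x y ↔ B.μ.part x < B.μ.part y := by
  refine ⟨?_, Or.inl⟩
  rintro (h | ⟨i, j, rfl, rfl, h⟩ | ⟨i, j, rfl, rfl, h⟩)
  · exact h
  · simp at hxy
  · simp at hxy

/-- By alternation, the part just before that of `x` lies in the other tree. The position of a part
is therefore determined recursively by the order alone. -/
theorem succ_le_part_iff (B : BinaryBitree m n) (k : ℕ) (x : Fin m ⊕ Fin n) :
    k + 1 ≤ B.μ.part x ↔ ∃ y, y.isLeft ≠ x.isLeft ∧ B.Rel y x ∧ k ≤ B.μ.part y := by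
  constructor
  · intro h
    obtain ⟨y, hy⟩ := B.μ.exists_part_eq x (B.μ.part x - 1) (by omega)
    have hne := B.alternating y x (by omega)
    exact ⟨y, hne, (B.rel_iff_part_lt hne).2 (by omega), by omega⟩
  · rintro ⟨y, hne, hr, hk⟩
    have := (B.rel_iff_part_lt hne).1 hr
    omega

theorem eq_of_rel_eq {B B' : BinaryBitree m n} (h : ∀ x y, B.Rel x y ↔ B'.Rel x y) :
    B = B' := by
  have hpart : ∀ k x, k ≤ B.μ.part x ↔ k ≤ B'.μ.part x := by
    intro k
    induction k with
    | zero => simp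
    | succ k ih =>
      intro x
      simp only [succ_le_part_iff, h, ih]
  refine BinaryBitree.ext ?_ ?_ (OrderedPartition.ext (funext fun x => ?_))
  · refine eq_of_isDescendant_le _ _ (B.numNodes_U.trans B'.numNodes_U.symm)
      (fun a b => ∃ i j : Fin m, a = i ∧ b = j ∧ B.Rel (Sum.inl j) (Sum.inl i)) ?_ ?_ ?_
    · rintro _ _ - - ⟨i, j, rfl, rfl, h1⟩ ⟨j', i', hj, hi, h2⟩
      obtain rfl := Fin.ext hi
      obtain rfl := Fin.ext hj
      rw [Sum.inl_injective (h2.antisymm h1)]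
    · intro a b hab
      have := hab.lt
      rw [B.numNodes_U] at this
      exact ⟨⟨a, this.1⟩, ⟨b, this.2⟩, rfl, rfl, Or.inr (Or.inl ⟨_, _, rfl, rfl, hab⟩)⟩
    · intro a b hab
      have := hab.lt
      rw [B'.numNodes_U] at this
      exact ⟨⟨a, this.1⟩, ⟨b, this.2⟩, rfl, rfl,
        (h _ _).2 (Or.inr (Or.inl ⟨_, _, rfl, rfl, hab⟩))⟩
  · refine eq_of_isDescendant_le _ _ (B.numNodes_D.trans B'.numNodes_D.symm)
      (fun a b => ∃ i j : Fin n, a = i ∧ b = j ∧ B.Rel (Sum.inr i) (Sum.inr j)) ?_ ?_ ?_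
    · rintro _ _ - - ⟨i, j, rfl, rfl, h1⟩ ⟨j', i', hj, hi, h2⟩
      obtain rfl := Fin.ext hi
      obtain rfl := Fin.ext hj
      rw [Sum.inr_injective (h1.antisymm h2)]
    · intro a b hab
      have := hab.lt
      rw [B.numNodes_D] at this
      exact ⟨⟨a, this.1⟩, ⟨b, this.2⟩, rfl, rfl, Or.inr (Or.inr ⟨_, _, rfl, rfl, hab⟩)⟩
    · intro a b hab
      have := hab.lt
      rw [B'.numNodes_D] at this
      exact ⟨⟨a, this.1⟩, ⟨b, this.2⟩, rfl, rfl,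
        (h _ _).2 (Or.inr (Or.inr ⟨_, _, rfl, rfl, hab⟩))⟩
  · exact le_antisymm ((hpart _ _).1 le_rfl) ((hpart _ _).2 le_rfl)

/-- The indicator function of the elements above `x` belongs to the cone and separates `x` from
everything not above it. -/
theorem rel_iff_forall_mem_cone (B : BinaryBitree m n) (x y : Fin m ⊕ Fin n) :
    B.Rel x y ↔ ∀ c ∈ B.cone, c x ≤ c y := by
  classical
  refine ⟨fun h c hc => hc _ _ h, fun h => ?_⟩
  have := h (fun z => if B.Rel x z then 1 else 0) ?_
  · by_contra hxy
    simp only [if_pos (Rel.refl B x), if_neg hxy] at this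
    linarith
  · intro z w hzw
    by_cases hz : B.Rel x z
    · simp [hz, hz.trans hzw]
    · simp only [if_neg hz]
      split_ifs <;> simp

theorem cone_injective : Function.Injective (cone : BinaryBitree m n → _) := by
  intro B B' h
  refine eq_of_rel_eq fun x y => ?_
  rw [rel_iff_forall_mem_cone, rel_iff_forall_mem_cone, h]

/-- A functional that is strictly monotone for the order of a bitree is maximized over the
biassociahedron only at its vertex. -/
theorem exists_unique_maximizer (B : BinaryBitree m n) :
    ∃ c ∈ B.cone, ∀ p ∈ biassociahedron m n, c ⬝ᵥ B.vertex ≤ c ⬝ᵥ p → p = B.vertex := by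
  classical
  let N : Fin m ⊕ Fin n → ℕ := fun x => (Finset.univ.filter fun y => B.Rel y x).card
  have hN : ∀ x y, B.Rel x y → x ≠ y → N x + 1 ≤ N y := by
    intro x y hxy hne
    refine Finset.card_lt_card (Finset.ssubset_iff_of_subset ?_ |>.2 ⟨y, ?_, ?_⟩)
    · intro z hz
      simp only [Finset.mem_filter, Finset.mem_univ, true_and] at hz ⊢
      exact hz.trans hxy
    · simpa using Rel.refl B y
    · simp only [Finset.mem_filter, Finset.mem_univ, true_and]
      exact fun h => hne (hxy.antisymm h)
  have hN' : ∀ x y, B.Rel x y → x ≠ y → (N x : ℝ) + 1 ≤ N y := fun x y h h' => by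
    exact_mod_cast hN x y h h'
  refine ⟨fun x => N x, fun x y hxy => ?_, fun p hp hle => ?_⟩
  · by_cases hne : x = y
    · rw [hne]
    · have := hN' x y hxy hne
      simp only
      linarith
  · set d := p - B.vertex with hd
    set S := ∑ x, |d x| with hS
    have hS0 : 0 ≤ S := Finset.sum_nonneg fun _ _ => abs_nonneg _
    have hdS : ∀ x, |d x| ≤ S := fun x =>
      Finset.single_le_sum (f := fun x => |d x|) (fun _ _ => abs_nonneg _) (Finset.mem_univ x)
    -- `N` grows by at least 1 along each strict relation, so the multiple grows by at least `2 * S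
    -- + 1`, while `d` varies by at most `2 * S`.
    have hmem : (fun x => (2 * S + 1) * (N x : ℝ)) + d ∈ B.cone := by
      intro x y hxy
      by_cases hne : x = y
      · rw [hne]
      · have h1 := hN' x y hxy hne
        have h2 := abs_le.1 (hdS x)
        have h3 := abs_le.1 (hdS y)
        simp only [Pi.add_apply]
        nlinarith
    have h1 := (B.dotProduct_vertex_eq_iff _).2 hmem
    have h2 := dotProduct_le_of_mem_biassociahedron hp ((fun x => (2 * S + 1) * (N x : ℝ)) + d)
    have e : (fun x => (2 * S + 1) * (N x : ℝ)) = (2 * S + 1) • fun x => (N x : ℝ) := rfl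
    rw [← h1, e, add_dotProduct, add_dotProduct, smul_dotProduct, smul_dotProduct, smul_eq_mul,
      smul_eq_mul] at h2
    have h3 : d ⬝ᵥ d = d ⬝ᵥ p - d ⬝ᵥ B.vertex := by rw [← dotProduct_sub]
    -- The perturbed functional is maximal at the vertex, whereas `N` is at least as large at `p`;
    -- hence `d` cannot be larger at `p`.
    have h4 : d ⬝ᵥ d ≤ 0 := by
      rw [h3]
      nlinarith
    have h5 : d ⬝ᵥ d = 0 :=
      le_antisymm h4 (Finset.sum_nonneg fun _ _ => mul_self_nonneg _)
    exact sub_eq_zero.1 (dotProduct_self_eq_zero.1 h5)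

end BinaryBitree

/-! ### The bitree of a linear functional -/

/-- For a function `f` separating the elements of different sides, the maximal number of changes
of side along a sequence ending at `x` on which `f` increases defines an ordered partition. -/
theorem exists_alternating_partition {α L : Type*} [Finite α] [LinearOrder L] (s : α → Bool)
    (f : α → L) (hf : ∀ x y, s x ≠ s y → f x ≠ f y) :
    ∃ μ : OrderedPartition α, (∀ x y, s x = s y → f x ≤ f y → μ.part x ≤ μ.part y) ∧
      (∀ x y, s x ≠ s y → f x < f y → μ.part x < μ.part y) ∧
      (∀ x y, μ.part x = μ.part y → s x = s y) ∧
      ∀ x y, μ.part y = μ.part x + 1 → s x ≠ s y := by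
  classical
  have := Fintype.ofFinite α
  have wf : WellFounded fun x y : α => f x < f y :=
    @Finite.wellFounded_of_trans_of_irrefl α _ _ ⟨fun _ _ _ => lt_trans⟩ ⟨fun _ => lt_irrefl _⟩
  -- Elements with no smaller element on the other side get position 0.
  let pt : α → ℕ := wf.fix fun x F => Finset.univ.sup fun y =>
    if h : s y ≠ s x ∧ f y < f x then F y h.2 + 1 else 0
  have hpt : ∀ x, pt x =
      Finset.univ.sup fun y => if s y ≠ s x ∧ f y < f x then pt y + 1 else 0 := by
    intro x
    simp only [pt]
    rw [wf.fix_eq]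
    rfl
  have hlt : ∀ x y, s x ≠ s y → f x < f y → pt x < pt y := by
    intro x y h h'
    rw [hpt y]
    refine lt_of_lt_of_le (Nat.lt_succ_self _) (le_trans (le_of_eq ?_)
      (Finset.le_sup (Finset.mem_univ x)))
    rw [if_pos ⟨h, h'⟩]
  have hle : ∀ x y, s x = s y → f x ≤ f y → pt x ≤ pt y := by
    intro x y h h'
    rw [hpt x]
    refine Finset.sup_le fun z _ => ?_
    split_ifs with hz
    · exact hlt z y (h ▸ hz.1) (hz.2.trans_le h')
    · exact Nat.zero_le _
  have hpred : ∀ x, 0 < pt x → ∃ y, s y ≠ s x ∧ f y < f x ∧ pt y + 1 = pt x := by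
    intro x hx
    obtain ⟨y, -, hy⟩ := Finset.exists_mem_eq_sup Finset.univ ⟨x, Finset.mem_univ x⟩
      fun y => if s y ≠ s x ∧ f y < f x then pt y + 1 else 0
    rw [← hpt x] at hy
    split_ifs at hy with h
    · exact ⟨y, h.1, h.2, hy.symm⟩
    · omega
  have hpure : ∀ x y, pt x = pt y → s x = s y := by
    intro x y h
    by_contra hne
    rcases lt_or_gt_of_ne (hf x y hne) with h' | h'
    · exact (hlt x y hne h').ne h
    · exact (hlt y x (Ne.symm hne) h').ne' h
  refine ⟨⟨pt, fun x => ?_⟩, hle, hlt, hpure, fun x y h => ?_⟩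
  · induction x using wf.induction with
    | _ x ih =>
      intro k hk
      obtain ⟨y, -, h2, h3⟩ := hpred x (by omega)
      rcases Nat.lt_or_ge k (pt y) with h | h
      · exact ih y h2 k h
      · exact ⟨y, by omega⟩
  · simp only at h
    -- The predecessor `z` of `y` has the position of `x`, hence its side, which differs from that
    -- of `y`.
    obtain ⟨z, h1, -, h3⟩ := hpred y (by omega)
    rw [← hpure z x (by omega)]
    exact h1

theorem exists_tree_monotone_fin {L : Type*} [LinearOrder L] (n : ℕ) (f : Fin n → L) :
    ∃ T : BinaryTree Unit, T.numNodes = n ∧ ∀ i j : Fin n, IsDescendant T i j → f i ≤ f j := by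
  rcases Nat.eq_zero_or_pos n with rfl | hn
  · exact ⟨.nil, rfl, fun i => i.elim0⟩
  · obtain ⟨T, hT, h⟩ := exists_tree_monotone n
      fun k => if hk : k < n then f ⟨k, hk⟩ else f ⟨0, hn⟩
    exact ⟨T, hT, fun i j hij => by simpa using h i j hij⟩

theorem exists_mem_cone {m n : ℕ} (c : Fin m ⊕ Fin n → ℝ) :
    ∃ B : BinaryBitree m n, c ∈ B.cone := by
  -- Ties of `c` between the two trees are broken by the side, so that no part can meet both.
  let f : Fin m ⊕ Fin n → ℝ ×ₗ Bool := fun x => toLex (c x, x.isLeft)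
  obtain ⟨μ, hle, hlt, hpure, halt⟩ := exists_alternating_partition Sum.isLeft f
    fun x y h h' => h (Prod.ext_iff.1 (toLex.injective h')).2
  obtain ⟨U, hU, hU'⟩ := exists_tree_monotone_fin m fun i => OrderDual.toDual (f (Sum.inl i))
  obtain ⟨D, hD, hD'⟩ := exists_tree_monotone_fin n fun j => f (Sum.inr j)
  have hcf : ∀ x y, f x ≤ f y → c x ≤ c y := fun x y h => by
    rcases Prod.Lex.le_iff.1 h with h | h
    · exact h.le
    · exact h.1.le
  refine ⟨⟨U, D, μ, hU, hD, fun i j h => hle _ _ rfl (hU' i j h),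
    fun i j h => hle _ _ rfl (hD' i j h), hpure, halt⟩, ?_⟩
  rintro x y (h | ⟨i, j, rfl, rfl, h⟩ | ⟨i, j, rfl, rfl, h⟩)
  · refine hcf _ _ (le_of_not_gt fun hlt' => ?_)
    by_cases hs : x.isLeft = y.isLeft
    · exact h.not_ge (hle _ _ hs.symm hlt'.le)
    · exact h.not_gt (hlt _ _ (Ne.symm hs) hlt')
  · exact hcf _ _ (hU' _ _ h)
  · exact hcf _ _ (hD' _ _ h)

/-! ### Normal cones of the vertices -/

namespace BinaryBitree

variable {m n : ℕ}

theorem dotProduct_le_vertex {B : BinaryBitree m n} {c : Fin m ⊕ Fin n → ℝ} (hc : c ∈ B.cone)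
    {p : Fin m ⊕ Fin n → ℝ} (hp : p ∈ biassociahedron m n) : c ⬝ᵥ p ≤ c ⬝ᵥ B.vertex :=
  (dotProduct_le_of_mem_biassociahedron hp c).trans_eq ((B.dotProduct_vertex_eq_iff c).2 hc).symm

theorem isVertexOf_vertex (B : BinaryBitree m n) : B.IsVertexOf B.vertex := by
  constructor
  · obtain ⟨c, hc, huniq⟩ := B.exists_unique_maximizer
    refine ⟨Set.singleton_nonempty _, c, Set.Subset.antisymm ?_ ?_⟩
    · rintro _ rfl
      exact ⟨B.vertex_mem, fun y hy => dotProduct_le_vertex hc hy⟩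
    · rintro p ⟨hp, hmax⟩
      exact huniq p hp (hmax _ B.vertex_mem)
  · ext c
    constructor
    · intro h
      -- The support bound of `c` is attained at the vertex of `B'`, so any maximizer of `c` attains
      -- it too.
      obtain ⟨B', hB'⟩ := exists_mem_cone c
      rw [← dotProduct_vertex_eq_iff]
      refine le_antisymm (dotProduct_le_of_mem_biassociahedron B.vertex_mem c) ?_
      rw [← (B'.dotProduct_vertex_eq_iff c).2 hB']
      exact h _ rfl _ B'.vertex_mem
    · rintro hc _ rfl p hp
      exact dotProduct_le_vertex hc hp

theorem IsVertexOf.eq_vertex {B : BinaryBitree m n} {v : Fin m ⊕ Fin n → ℝ}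
    (h : B.IsVertexOf v) : v = B.vertex := by
  obtain ⟨c, hc, huniq⟩ := B.exists_unique_maximizer
  obtain ⟨⟨-, c', hv⟩, hcone⟩ := h
  refine huniq v ((Set.ext_iff.1 hv v).1 rfl).1 ?_
  rw [← hcone] at hc
  exact hc v rfl _ B.vertex_mem

end BinaryBitree

end Biassociahedra

theorem mainTheorem9 (m n : ℕ) :
    (∀ B : Biassociahedra.BinaryBitree m n, ∃! v : Fin m ⊕ Fin n → ℝ, B.IsVertexOf v) ∧
    (∀ v : Fin m ⊕ Fin n → ℝ,
      Biassociahedra.IsVertex (Biassociahedra.biassociahedron m n) v →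
        ∃! B : Biassociahedra.BinaryBitree m n, B.IsVertexOf v) ∧
    (∀ (B : Biassociahedra.BinaryBitree m n) (v : Fin m ⊕ Fin n → ℝ), B.IsVertexOf v →
      (∀ i : Fin m, v (Sum.inl i) =
        (m + 1 : ℝ) - (Biassociahedra.leafProduct B.U i : ℝ) + (B.numBelowU i : ℝ)) ∧
      (∀ j : Fin n, v (Sum.inr j) =
        (Biassociahedra.leafProduct B.D j : ℝ) + (B.numBelowD j : ℝ)) ∧
      ∑ x, v x = ((m + 1).choose 2 : ℝ) + ((n + 1).choose 2 : ℝ) + (m : ℝ) * (n : ℝ)) := by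
  refine ⟨fun B => ⟨B.vertex, B.isVertexOf_vertex, fun v hv => hv.eq_vertex⟩, fun v hv => ?_,
    fun B v hv => ?_⟩
  · obtain ⟨-, c, hc⟩ := hv
    -- The functional `c` is maximized only at `v`, but also at the vertex of any bitree whose cone
    -- contains it.
    obtain ⟨B, hB⟩ := Biassociahedra.exists_mem_cone c
    have hBv : B.vertex ∈ ({v} : Set (Fin m ⊕ Fin n → ℝ)) := by
      rw [hc]
      exact ⟨B.vertex_mem, fun y hy => Biassociahedra.BinaryBitree.dotProduct_le_vertex hB hy⟩
    obtain rfl : B.vertex = v := hBv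
    exact ⟨B, B.isVertexOf_vertex, fun B' hB' =>
      Biassociahedra.BinaryBitree.cone_injective (hB'.2.symm.trans B.isVertexOf_vertex.2)⟩
  · obtain rfl := hv.eq_vertex
    exact ⟨fun i => rfl, fun j => rfl, B.sum_vertex⟩
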